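/- Consider $m$ agents, agent $i$ having a finite nonempty set $\mathcal A_i$ of individual arms, and $\rho$ groups $G_1,\dots,G_\rho\subseteq[m]$ of agents (possibly overlapping), the hyperedges of a coordination hypergraph. A joint arm is $\boldsymbol a\in\mathcal A_1\times\cdots\times\mathcal A_m$; its local arm for group $e$ is $\boldsymbol a^e=(a_i)_{i\in G_e}\in\mathcal A^e:=\prod_{i\in G_e}\mathcal A_i$, and $A_{\mathrm{loc}}=\sum_{e=1}^\rho\prod_{i\in G_e}|\mathcal A_i|$ is the total number of local arms. Assume that some group contains an agent with at least two arms. For a vector $\mu\in[0,1]^{A_{\mathrm{loc}}}$ of means of the local arms and $0<\sigma\le 1$, let $\nu_\mu=\nu_{\mu,\sigma}$ be the bandit instance in which pulling the joint arm $\boldsymbol a$ yields, independently over groups and rounds, local rewards $f^e(\boldsymbol a^e)\sim\mathcal N(\mu_{\boldsymbol a^e},\sigma^2)$, $e\in[\rho]$, with global reward $f(\boldsymbol a)=\sum_e f^e(\boldsymbol a^e)$, whose mean is $\mu_{\boldsymbol a}=\sum_e\mu_{\boldsymbol a^e}$. A policy $\pi$ chooses the joint arm $\boldsymbol A_t$ of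 round $t$, possibly at random, depending on the joint arms and all local rewards of the earlier rounds, and its regret over $T$ rounds is $$R_T(\pi,\nu_\mu)=\mathbb E\Big[\sum_{t=1}^T\big(\max_{\boldsymbol a}\mu_{\boldsymbol a}-f(\boldsymbol A_t)\big)\Big].$$ **Theorem.** There is a universal constant $c>0$ such that, for every such hypergraph, every $\sigma\in(0,1]$, every horizon $T\ge A_{\mathrm{loc}}/\rho$ and every policy $\pi$, there is a vector $\mu\in[0,1]^{A_{\mathrm{loc}}}$ of local-arm means with $$R_T(\pi,\nu_{\mu,\sigma})\ \ge\ c\,\sigma\sqrt{\frac{A_{\mathrm{loc}}\,T}{\rho}}.$$ In particular, for unit-variance Gaussian rewards the regret is $\Omega(\sqrt{A_{\mathrm{loc}}T/\rho})$. -/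

import Mathlib

open MeasureTheory ProbabilityTheory
open scoped NNReal

/-- A coordination hypergraph: finitely many agents, a finite set of individual arms for each
agent, and a family of (possibly overlapping) groups of agents, the hyperedges. -/
structure CoordHypergraph where
  /-- the number of agents -/
  numAgents : ℕ
  /-- the number of groups (hyperedges) -/
  numGroups : ℕ
  /-- the number of individual arms of each agent -/
  numArms : Fin numAgents → ℕ
  /-- the set of agents in each group -/
  group : Fin numGroups → Finset (Fin numAgents)

namespace CoordHypergraph

/-- A joint arm: one individual arm for every agent. -/
abbrev JointArm (H : CoordHypergraph) : Type :=
  (i : Fin H.numAgents) → Fin (H.numArms i)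

/-- A local arm of group `e`: one individual arm for every agent of the group. -/
abbrev LocalArm (H : CoordHypergraph) (e : Fin H.numGroups) : Type :=
  (i : {i : Fin H.numAgents // i ∈ H.group e}) → Fin (H.numArms i.1)

/-- The local arm of group `e` contained in the joint arm `a`. -/
def localPart (H : CoordHypergraph) (a : H.JointArm) (e : Fin H.numGroups) : H.LocalArm e :=
  fun i => a i.1

/-- The total number of local arms, over all groups. -/
def numLocalArms (H : CoordHypergraph) : ℕ :=
  ∑ e : Fin H.numGroups, Fintype.card (H.LocalArm e)

/-- A vector with one real component (the mean reward) for every local arm of every group. -/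
abbrev MeanVector (H : CoordHypergraph) : Type :=
  (e : Fin H.numGroups) → H.LocalArm e → ℝ

/-- The mean reward of a joint arm: the sum of the means of its local arms. -/
def jointMean (H : CoordHypergraph) (μ : H.MeanVector) (a : H.JointArm) : ℝ :=
  ∑ e : Fin H.numGroups, μ e (H.localPart a e)

/-- The mean reward of the best joint arm (a maximum over a finite set). -/
noncomputable def optMean (H : CoordHypergraph) (μ : H.MeanVector) : ℝ :=
  ⨆ a : H.JointArm, H.jointMean μ a

/-- The feedback of one round: the local reward of every group. -/
abbrev Feedback (H : CoordHypergraph) : Type :=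
  Fin H.numGroups → ℝ

/-- One round of interaction: the joint arm that was pulled and the feedback received. -/
abbrev Round (H : CoordHypergraph) : Type :=
  H.JointArm × H.Feedback

/-- The history of the first `t` rounds. -/
abbrev History (H : CoordHypergraph) (t : ℕ) : Type :=
  Fin t → H.Round

/-- The Gaussian hypergraph bandit instance with mean vector `μ` and noise level `σ`: when the
joint arm `a` is pulled, the groups' local rewards are independent, and that of group `e` is
Gaussian with variance `σ ^ 2` and mean the component of `μ` at the local arm of `a` in `e`. -/
noncomputable def gaussianInstance (H : CoordHypergraph) (μ : H.MeanVector) (σ : ℝ≥0) :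
    Kernel H.JointArm H.Feedback :=
  Kernel.ofFunOfCountable fun a =>
    Measure.pi fun e : Fin H.numGroups => gaussianReal (μ e (H.localPart a e)) (σ ^ 2)

/-- A (randomized) policy: for each round, a probability distribution on joint arms that depends
measurably on the history of joint arms and local rewards. -/
structure Policy (H : CoordHypergraph) where
  /-- the law of the next joint arm given the history of the first `t` rounds -/
  act : (t : ℕ) → Kernel (H.History t) H.JointArm
  /-- these laws are probability measures -/
  markov : ∀ t, IsMarkovKernel (act t)

/-- The law of the history of the first `t` rounds when policy `π` interacts with the bandit
instance `ν`, a Markov kernel from joint arms to feedback. -/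
noncomputable def historyLaw (H : CoordHypergraph) (π : H.Policy)
    (ν : Kernel H.JointArm H.Feedback) : (t : ℕ) → Measure (H.History t)
  | 0 => Measure.dirac Fin.elim0
  | t + 1 =>
      (H.historyLaw π ν t ⊗ₘ (π.act t ⊗ₖ Kernel.prodMkLeft (H.History t) ν)).map
        fun p => Fin.snoc (α := fun _ => H.Round) p.1 p.2

/-- The regret over `T` rounds of policy `π` on the Gaussian instance with mean vector `μ` and
noise level `σ`: the expectation of the sum over the rounds of the best mean reward minus the
global reward received, which is the sum of the local rewards. -/
noncomputable def regret (H : CoordHypergraph) (π : H.Policy) (μ : H.MeanVector) (σ : ℝ≥0)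
    (T : ℕ) : ℝ :=
  ∫ h, ∑ t : Fin T, (H.optMean μ - ∑ e : Fin H.numGroups, (h t).2 e)
    ∂(H.historyLaw π (H.gaussianInstance μ σ) T)

end CoordHypergraph

/-! Only one group has to be made hard. A group `e` with the most local arms has `n ≥ A_loc / ρ` of
them. The reference instance has all means zero, and for each local arm `x` of `e` there is an
alternative raising that single mean to `D`. Every joint arm missing `x` then loses exactly `D`, so
the regret is `D (T - E_x N_x)`, with `N_x` the number of plays of `x`.

Under the reference instance the `E_0 N_x` sum to `T`, because one local arm of `e` is played per
round. The two history laws have divergence `D² E_0 N_x / (2σ²)`, since only plays of `x` carry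
information. If `D² T` is at most a small multiple of `σ² n`, the change of measure
`integral_withDensity_exp_le` therefore gives `E_x N_x ≤ 11 T / 16` on average over `x`, hence for
some `x` (`exists_integral_playCount_single_le`). Taking `D` of order `σ √(A_loc / (ρ T))` gives the
bound. -/

/-! ### Densities and change of measure. -/

theorem MeasureTheory.Measure.pi_withDensity {ι : Type*} [Fintype ι] {X : ι → Type*}
    [∀ i, MeasurableSpace (X i)] (μ : ∀ i, Measure (X i)) [∀ i, IsProbabilityMeasure (μ i)]
    {f : ∀ i, X i → ENNReal} (hf : ∀ i, Measurable (f i))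
    [∀ i, SigmaFinite ((μ i).withDensity (f i))] :
    Measure.pi (fun i => (μ i).withDensity (f i)) =
      (Measure.pi μ).withDensity (fun x => ∏ i, f i (x i)) := by
  classical
  refine Measure.pi_eq fun s hs => ?_
  have hind : ∀ i, Measurable ((s i).indicator (f i)) := fun i => (hf i).indicator (hs i)
  have hI := iIndepFun_pi (μ := μ) (X := fun i => (s i).indicator (f i))
    fun i => (hind i).aemeasurable
  rw [withDensity_apply _ (MeasurableSet.univ_pi hs),
    ← lintegral_indicator (MeasurableSet.univ_pi hs)]
  have heq : (Set.univ.pi s).indicator (fun x => ∏ i, f i (x i)) =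
      fun x => ∏ i, (s i).indicator (f i) (x i) := by
    ext x
    by_cases hx : x ∈ Set.univ.pi s
    · rw [Set.indicator_of_mem hx]
      exact Finset.prod_congr rfl fun i _ => (Set.indicator_of_mem (hx i trivial) _).symm
    · rw [Set.indicator_of_notMem hx]
      simp only [Set.mem_univ_pi, not_forall] at hx
      obtain ⟨i, hi⟩ := hx
      exact (Finset.prod_eq_zero (Finset.mem_univ i) (Set.indicator_of_notMem hi _)).symm
  rw [heq, lintegral_prod_eq_prod_lintegral_of_indepFun Finset.univ _ hI
    fun i => (hind i).comp (measurable_pi_apply i)]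
  refine Finset.prod_congr rfl fun i _ => ?_
  rw [withDensity_apply _ (hs i), ← lintegral_indicator (hs i),
    ← (measurePreserving_eval μ i).lintegral_comp (hind i)]

theorem ProbabilityTheory.gaussianReal_eq_withDensity_gaussianReal_zero (m : ℝ) {v : ℝ≥0}
    (hv : v ≠ 0) :
    gaussianReal m v = (gaussianReal 0 v).withDensity
      (fun y => ENNReal.ofReal (Real.exp ((m * y - m ^ 2 / 2) / v))) := by
  rw [gaussianReal_of_var_ne_zero _ hv, gaussianReal_of_var_ne_zero _ hv,
    ← withDensity_mul _ (measurable_gaussianPDF _ _) (by fun_prop)]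
  congr 1
  ext y
  have hv' : (v : ℝ) ≠ 0 := by exact_mod_cast hv
  rw [Pi.mul_apply, gaussianPDF, gaussianPDF, ← ENNReal.ofReal_mul (gaussianPDFReal_nonneg _ _ _)]
  simp only [gaussianPDFReal]
  rw [mul_assoc _ (Real.exp _) (Real.exp _), ← Real.exp_add]
  congr 3
  field_simp
  ring

/-- Change of measure: an expectation moves by at most a multiple of
`2 * l + KL(P, P.withDensity (exp g)) / (2 * l)`. -/
theorem integral_withDensity_exp_le {Ω : Type*} [MeasurableSpace Ω] (P : Measure Ω)
    [IsProbabilityMeasure P] {g : Ω → ℝ} (hg : Measurable g) (hgi : Integrable g P)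
    (hL : IsProbabilityMeasure (P.withDensity fun w => ENNReal.ofReal (Real.exp (g w))))
    {f : Ω → ℝ} (hf : Measurable f) {B : ℝ} (hf0 : ∀ w, 0 ≤ f w) (hfB : ∀ w, f w ≤ B)
    {l : ℝ} (hl : 0 < l) :
    ∫ w, f w ∂(P.withDensity fun w => ENNReal.ofReal (Real.exp (g w))) ≤
      ∫ w, f w ∂P + B * (2 * l + (-∫ w, g w ∂P) / (2 * l)) := by
  have hexp : Measurable fun w => Real.exp (g w) := by fun_prop
  have hlint : ∫⁻ w, ENNReal.ofReal (Real.exp (g w)) ∂P = 1 := by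
    have := hL.measure_univ
    rwa [withDensity_apply _ MeasurableSet.univ, Measure.restrict_univ] at this
  have hLi : Integrable (fun w => Real.exp (g w)) P := by
    refine ⟨hexp.aestronglyMeasurable, ?_⟩
    rw [hasFiniteIntegral_iff_ofReal (.of_forall fun w => (Real.exp_pos _).le), hlint]
    exact ENNReal.one_lt_top
  have hL1 : ∫ w, Real.exp (g w) ∂P = 1 := by
    rw [integral_eq_lintegral_of_nonneg_ae (.of_forall fun w => (Real.exp_pos _).le)
      hexp.aestronglyMeasurable, hlint, ENNReal.toReal_one]
  have hfi : Integrable f P :=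
    .of_bound hf.aestronglyMeasurable B
      (.of_forall fun w => by rw [Real.norm_eq_abs, abs_of_nonneg (hf0 w)]; exact hfB w)
  have hfL : Integrable (fun w => Real.exp (g w) * f w) P :=
    hLi.mul_bdd (c := B) hf.aestronglyMeasurable
      (.of_forall fun w => by rw [Real.norm_eq_abs, abs_of_nonneg (hf0 w)]; exact hfB w)
  rw [integral_withDensity_eq_integral_toReal_smul (by fun_prop) (by simp)]
  simp only [ENNReal.toReal_ofReal (Real.exp_pos _).le, smul_eq_mul]
  -- A pointwise substitute for Pinsker's inequality. It is linear in the divergence, so it can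
  -- later be summed over arms without Jensen or Cauchy–Schwarz. With `s = exp (g / 2)`, weighted
  -- AM-GM is applied to `(s - 1) * (s + 1)`, then `(s + 1)² ≤ 2 (s² + 1)` and `(s - 1)² ≤ s² - 1 -
  -- g`.
  have hpt : ∀ w, Real.exp (g w) * f w ≤
      f w + B * (l * (Real.exp (g w) + 1) + (Real.exp (g w) - 1 - g w) / (2 * l)) := by
    intro w
    set s := Real.exp (g w / 2) with hs
    have hsq : Real.exp (g w) = s ^ 2 := by
      rw [hs, ← Real.exp_nat_mul]; congr 1; push_cast; ring
    have hs1 : g w ≤ 2 * s - 2 := by have := Real.add_one_le_exp (g w / 2); linarith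
    have hspos : 0 < s := Real.exp_pos _
    rw [hsq]
    have hB := (hf0 w).trans (hfB w)
    have h1 : s ^ 2 - 1 ≤ l * (s ^ 2 + 1) + (s ^ 2 - 1 - g w) / (2 * l) := by
      have h2 : (s - 1) ^ 2 / (2 * l) ≤ (s ^ 2 - 1 - g w) / (2 * l) := by
        gcongr; nlinarith
      have h3 : s ^ 2 - 1 ≤ l / 2 * (s + 1) ^ 2 + (s - 1) ^ 2 / (2 * l) := by
        have : l / 2 * (s + 1) ^ 2 + (s - 1) ^ 2 / (2 * l) - (s ^ 2 - 1)
            = (l * (s + 1) - (s - 1)) ^ 2 / (2 * l) := by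
          field_simp; ring
        have : 0 ≤ (l * (s + 1) - (s - 1)) ^ 2 / (2 * l) := by positivity
        linarith
      nlinarith [mul_nonneg hl.le (sq_nonneg (s - 1))]
    have h0 : 0 ≤ l * (s ^ 2 + 1) + (s ^ 2 - 1 - g w) / (2 * l) := by
      have : 0 ≤ s ^ 2 - 1 - g w := by nlinarith [sq_nonneg (s - 1)]
      positivity
    have h4 := mul_le_mul_of_nonneg_left h1 (hf0 w)
    have h5 := mul_le_mul_of_nonneg_right (hfB w) h0
    linarith
  have hr0 : Integrable (fun w => Real.exp (g w) - 1) P := hLi.sub (integrable_const _)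
  have hr : Integrable (fun w => Real.exp (g w) - 1 - g w) P :=
    hr0.sub hgi
  have hr2 : Integrable (fun w => l * (Real.exp (g w) + 1)) P :=
    (hLi.add (integrable_const _)).const_mul _
  have hr3 : Integrable (fun w => (Real.exp (g w) - 1 - g w) / (2 * l)) P := hr.div_const _
  have hr4 : Integrable (fun w =>
      B * (l * (Real.exp (g w) + 1) + (Real.exp (g w) - 1 - g w) / (2 * l))) P :=
    (hr2.add hr3).const_mul _
  refine (integral_mono hfL (hfi.add hr4) hpt).trans_eq ?_
  simp only [Pi.add_apply]
  rw [integral_add hfi hr4, integral_const_mul, integral_add hr2 hr3, integral_const_mul,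
    integral_div, integral_add hLi (integrable_const _),
    integral_sub hr0 hgi, integral_sub hLi (integrable_const _), hL1]
  simp only [integral_const, probReal_univ, smul_eq_mul]
  ring

/-! ### Laws of histories. -/

namespace CoordHypergraph

variable {H : CoordHypergraph}

theorem measurable_snoc_history (H : CoordHypergraph) (t : ℕ) :
    Measurable fun p : H.History t × H.Round =>
      (Fin.snoc (α := fun _ => H.Round) p.1 p.2 : H.History (t + 1)) := by
  refine measurable_pi_iff.2 fun i => ?_
  refine Fin.lastCases ?_ (fun j => ?_) i
  · simpa only [Fin.snoc_last] using measurable_snd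
  · simp only [Fin.snoc_castSucc]
    exact (measurable_pi_apply j).comp measurable_fst

instance isProbabilityMeasure_historyLaw (π : H.Policy) (ν : Kernel H.JointArm H.Feedback)
    [IsMarkovKernel ν] (t : ℕ) : IsProbabilityMeasure (H.historyLaw π ν t) := by
  induction t with
  | zero => exact Measure.dirac.isProbabilityMeasure
  | succ t ih =>
    have := π.markov t
    exact Measure.isProbabilityMeasure_map (H.measurable_snoc_history t).aemeasurable

theorem lintegral_historyLaw_succ (π : H.Policy) (ν : Kernel H.JointArm H.Feedback)
    [IsMarkovKernel ν] (t : ℕ) {F : H.History (t + 1) → ENNReal} (hF : Measurable F) :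
    ∫⁻ h, F h ∂(H.historyLaw π ν (t + 1)) =
      ∫⁻ h, ∫⁻ a, ∫⁻ y, F (Fin.snoc (α := fun _ => H.Round) h (a, y)) ∂(ν a) ∂(π.act t h)
        ∂(H.historyLaw π ν t) := by
  have := π.markov t
  have hs : Measurable fun p : H.History t × H.Round =>
      F (Fin.snoc (α := fun _ => H.Round) p.1 p.2) := hF.comp (H.measurable_snoc_history t)
  rw [historyLaw, lintegral_map hF (H.measurable_snoc_history t),
    Measure.lintegral_compProd hs]
  refine lintegral_congr fun h => ?_
  exact Kernel.lintegral_compProd _ _ _ (hs.comp measurable_prodMk_left)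

/-- If the feedback laws have densities `exp Φ`, then so have the history laws, with the sum of
`Φ` over the rounds as log-likelihood ratio. -/
theorem historyLaw_eq_withDensity (π : H.Policy) (ν ν' : Kernel H.JointArm H.Feedback)
    [IsMarkovKernel ν] [IsMarkovKernel ν'] {Φ : H.Round → ℝ} (hΦ : Measurable Φ)
    (hν : ∀ a, ν' a = (ν a).withDensity fun y => ENNReal.ofReal (Real.exp (Φ (a, y)))) (t : ℕ) :
    H.historyLaw π ν' t = (H.historyLaw π ν t).withDensity
      fun h => ENNReal.ofReal (Real.exp (∑ s, Φ (h s))) := by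
  induction t with
  | zero =>
    have : (fun h : H.History 0 => ENNReal.ofReal (Real.exp (∑ s, Φ (h s)))) = 1 := by
      ext h; simp
    rw [this, withDensity_one]
    rfl
  | succ t ih =>
    have := π.markov t
    have hmeas : ∀ t, Measurable fun h : H.History t =>
        ENNReal.ofReal (Real.exp (∑ s, Φ (h s))) := fun t => by fun_prop
    have hround : Measurable fun r : H.Round => ENNReal.ofReal (Real.exp (Φ r)) := by fun_prop
    refine Measure.ext_of_lintegral _ fun F hF => ?_
    rw [lintegral_withDensity_eq_lintegral_mul _ (hmeas _) hF, lintegral_historyLaw_succ π ν' t hF,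
      lintegral_historyLaw_succ π ν t ((hmeas _).mul hF), ih]
    have hsn : Measurable fun p : H.History t × H.Round =>
        F (Fin.snoc (α := fun _ => H.Round) p.1 p.2) := hF.comp (H.measurable_snoc_history t)
    have hpair : ∀ (h : H.History t) (a : H.JointArm),
        Measurable fun y : H.Feedback => (h, ((a, y) : H.Round)) := fun h a =>
      measurable_prodMk_left.comp measurable_prodMk_left
    have key : ∀ h : H.History t, ∀ a, ∫⁻ y, F (Fin.snoc (α := fun _ => H.Round) h (a, y)) ∂(ν' a) =
        ∫⁻ y, ENNReal.ofReal (Real.exp (Φ (a, y))) *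
          F (Fin.snoc (α := fun _ => H.Round) h (a, y)) ∂(ν a) := by
      intro h a
      have h1 : Measurable fun y => ENNReal.ofReal (Real.exp (Φ (a, y))) :=
        hround.comp measurable_prodMk_left
      have h2 : Measurable fun y : H.Feedback => F (Fin.snoc (α := fun _ => H.Round) h (a, y)) :=
        hsn.comp (hpair h a)
      rw [hν a, lintegral_withDensity_eq_lintegral_mul _ h1 h2]
      rfl
    simp only [key]
    have hG : Measurable fun p : H.History t × H.Round => ENNReal.ofReal (Real.exp (Φ p.2)) *
          F (Fin.snoc (α := fun _ => H.Round) p.1 p.2) := (hround.comp measurable_snd).mul hsn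
    have hG1 : ∀ h : H.History t, Measurable fun a => ∫⁻ y, ENNReal.ofReal (Real.exp (Φ (a, y))) *
          F (Fin.snoc (α := fun _ => H.Round) h (a, y)) ∂(ν a) := fun h => Measurable.of_discrete
    have hG2 : Measurable fun h : H.History t =>
        ∫⁻ a, ∫⁻ y, ENNReal.ofReal (Real.exp (Φ (a, y))) *
          F (Fin.snoc (α := fun _ => H.Round) h (a, y)) ∂(ν a) ∂(π.act t h) := by
      -- The iterated integral is one integral against the composed arm-and-feedback kernel, whence
      -- its measurability in `h`.
      have := Measurable.lintegral_kernel_prod_right'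
        (κ := π.act t ⊗ₖ Kernel.prodMkLeft (H.History t) ν) hG
      have heq := fun h : H.History t => Kernel.lintegral_compProd (π.act t)
        (Kernel.prodMkLeft (H.History t) ν) h (hG.comp (measurable_prodMk_left (x := h)))
      exact (funext heq : _ = _) ▸ this
    rw [lintegral_withDensity_eq_lintegral_mul _ (hmeas _) hG2]
    refine lintegral_congr fun h => ?_
    rw [Pi.mul_apply, ← lintegral_const_mul _ (hG1 h)]
    refine lintegral_congr fun a => ?_
    refine (lintegral_const_mul _ (hG.comp (hpair h a))).symm.trans ?_
    refine lintegral_congr fun y => ?_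
    rw [Pi.mul_apply, Fin.sum_univ_castSucc, Function.comp_apply]
    simp only [Fin.snoc_last, Fin.snoc_castSucc]
    rw [Real.exp_add, ENNReal.ofReal_mul (Real.exp_pos _).le, mul_assoc]

theorem map_init_historyLaw (π : H.Policy) (ν : Kernel H.JointArm H.Feedback) [IsMarkovKernel ν]
    (t : ℕ) : (H.historyLaw π ν (t + 1)).map (fun h s => h (Fin.castSucc s)) =
      H.historyLaw π ν t := by
  have := π.markov t
  have hm : Measurable fun (h : H.History (t + 1)) (s : Fin t) => h (Fin.castSucc s) := by fun_prop
  rw [historyLaw, Measure.map_map hm (H.measurable_snoc_history t)]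
  have : (fun (h : H.History (t + 1)) (s : Fin t) => h (Fin.castSucc s)) ∘
      (fun p : H.History t × H.Round => Fin.snoc (α := fun _ => H.Round) p.1 p.2) = Prod.fst := by
    ext p : 1
    funext s
    simp
  rw [this]
  exact Measure.fst_compProd _ _

/-- Conditionally on the joint arm pulled in a round, its feedback has law `ν`. -/
theorem exists_map_eval_historyLaw (π : H.Policy) (ν : Kernel H.JointArm H.Feedback)
    [IsMarkovKernel ν] (t : ℕ) (s : Fin t) :
    ∃ m : Measure H.JointArm, IsProbabilityMeasure m ∧
      (H.historyLaw π ν t).map (fun h => h s) = m ⊗ₘ ν := by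
  induction t with
  | zero => exact s.elim0
  | succ t ih =>
    refine Fin.lastCases ?_ (fun j => ?_) s
    · have := π.markov t
      -- The arm of the last round is distributed as the policy's choice averaged over the past.
      refine ⟨(π.act t) ∘ₘ (H.historyLaw π ν t), inferInstance, ?_⟩
      rw [historyLaw, Measure.map_map (measurable_pi_apply _) (H.measurable_snoc_history t)]
      have : (fun h : H.History (t + 1) => h (Fin.last t)) ∘
          (fun p : H.History t × H.Round => Fin.snoc (α := fun _ => H.Round) p.1 p.2) =
          Prod.snd := by
        ext p : 1
        simp
      rw [this]
      refine Measure.ext_of_lintegral _ fun F hF => ?_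
      rw [lintegral_map hF measurable_snd,
        Measure.lintegral_compProd (f := fun p : H.History t × H.Round => F p.2)
          (hF.comp measurable_snd),
        Measure.lintegral_compProd hF, Measure.lintegral_bind (by fun_prop)
          (Measurable.of_discrete).aemeasurable]
      refine lintegral_congr fun h => ?_
      exact Kernel.lintegral_compProd _ _ _ hF
    · obtain ⟨m, hm, h⟩ := ih j
      refine ⟨m, hm, ?_⟩
      rw [← h, ← map_init_historyLaw π ν t, Measure.map_map (measurable_pi_apply _) (by fun_prop)]
      rfl

theorem integrable_comp_eval_historyLaw (π : H.Policy) (ν : Kernel H.JointArm H.Feedback)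
    [IsMarkovKernel ν] {φ : H.Round → ℝ} (hφ : Measurable φ)
    (hi : ∀ a, Integrable (fun y => φ (a, y)) (ν a)) (t : ℕ) (s : Fin t) :
    Integrable (fun h => φ (h s)) (H.historyLaw π ν t) := by
  obtain ⟨m, hm, h⟩ := exists_map_eval_historyLaw π ν t s
  have : Integrable φ ((H.historyLaw π ν t).map fun h => h s) := by
    rw [h, Measure.integrable_compProd_iff hφ.aestronglyMeasurable]
    exact ⟨.of_forall hi, .of_finite⟩
  exact this.comp_measurable (measurable_pi_apply s)

/-- Conditioning on the arm pulled. This turns rewards into means in the regret, and log-likelihood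
ratios into per-round divergences. Integrability arm by arm suffices because there are finitely many
joint arms. -/
theorem integral_comp_eval_historyLaw (π : H.Policy) (ν : Kernel H.JointArm H.Feedback)
    [IsMarkovKernel ν] {φ : H.Round → ℝ} (hφ : Measurable φ)
    (hi : ∀ a, Integrable (fun y => φ (a, y)) (ν a)) (t : ℕ) (s : Fin t) :
    ∫ h, φ (h s) ∂(H.historyLaw π ν t) =
      ∫ h, (∫ y, φ ((h s).1, y) ∂(ν (h s).1)) ∂(H.historyLaw π ν t) := by
  obtain ⟨m, hm, h⟩ := exists_map_eval_historyLaw π ν t s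
  have hint : Integrable φ (m ⊗ₘ ν) := by
    rw [Measure.integrable_compProd_iff hφ.aestronglyMeasurable]
    exact ⟨.of_forall hi, .of_finite⟩
  have hψ : Measurable fun r : H.Round => ∫ y, φ (r.1, y) ∂(ν r.1) :=
    (Measurable.of_discrete (f := fun a => ∫ y, φ (a, y) ∂(ν a))).comp measurable_fst
  have h1 := integral_map (μ := H.historyLaw π ν t) (measurable_pi_apply s).aemeasurable
    (f := φ) hφ.aestronglyMeasurable
  have h2 := integral_map (μ := H.historyLaw π ν t) (measurable_pi_apply s).aemeasurable
    (f := fun r : H.Round => ∫ y, φ (r.1, y) ∂(ν r.1)) hψ.aestronglyMeasurable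
  rw [← h1, ← h2, h, Measure.integral_compProd hint, Measure.integral_compProd]
  · simp
  · rw [Measure.integrable_compProd_iff hψ.aestronglyMeasurable]
    exact ⟨.of_forall fun a => integrable_const (∫ y, φ (a, y) ∂(ν a)), .of_finite⟩

/-! ### Gaussian instances: likelihood ratios, regret and divergence. -/

instance isMarkovKernel_gaussianInstance (μ : H.MeanVector) (σ : ℝ≥0) :
    IsMarkovKernel (H.gaussianInstance μ σ) :=
  ⟨fun _ => inferInstanceAs (IsProbabilityMeasure (Measure.pi _))⟩

theorem gaussianInstance_apply (μ : H.MeanVector) (σ : ℝ≥0) (a : H.JointArm) :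
    H.gaussianInstance μ σ a =
      Measure.pi fun e => gaussianReal (μ e (H.localPart a e)) (σ ^ 2) := rfl

/-- The log-likelihood ratio of one round of the instance with means `μ` against the one with
zero means. -/
noncomputable def logLikelihood (μ : H.MeanVector) (σ : ℝ≥0) (r : H.Round) : ℝ :=
  ∑ e, (μ e (H.localPart r.1 e) * r.2 e - μ e (H.localPart r.1 e) ^ 2 / 2) / (σ ^ 2 : ℝ≥0)

theorem measurable_logLikelihood (μ : H.MeanVector) (σ : ℝ≥0) :
    Measurable (logLikelihood μ σ) := by
  have h : ∀ e, Measurable fun r : H.Round => μ e (H.localPart r.1 e) := fun e =>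
    (Measurable.of_discrete (f := fun a => μ e (H.localPart a e))).comp measurable_fst
  refine Finset.measurable_sum _ fun e _ => ?_
  exact ((((h e).mul ((measurable_pi_apply e).comp measurable_snd)).sub
    (((h e).pow_const 2).div_const 2))).div_const _

theorem gaussianInstance_eq_withDensity (μ : H.MeanVector) {σ : ℝ≥0} (hσ : σ ≠ 0)
    (a : H.JointArm) :
    H.gaussianInstance μ σ a = (H.gaussianInstance 0 σ a).withDensity
      fun y => ENNReal.ofReal (Real.exp (logLikelihood μ σ (a, y))) := by
  have hv : σ ^ 2 ≠ 0 := pow_ne_zero 2 hσ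
  have hd := fun e => gaussianReal_eq_withDensity_gaussianReal_zero (μ e (H.localPart a e)) hv
  have : ∀ e, SigmaFinite ((gaussianReal 0 (σ ^ 2)).withDensity fun y => ENNReal.ofReal (Real.exp
      ((μ e (H.localPart a e) * y - μ e (H.localPart a e) ^ 2 / 2) / (σ ^ 2 : ℝ≥0)))) := fun e => by
    rw [← hd e]; infer_instance
  rw [gaussianInstance_apply, gaussianInstance_apply]
  simp only [hd, Pi.zero_apply]
  rw [Measure.pi_withDensity (fun _ => gaussianReal 0 (σ ^ 2)) (fun e => by fun_prop)]
  congr 1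
  ext y
  rw [← ENNReal.ofReal_prod_of_nonneg fun e _ => (Real.exp_pos _).le, ← Real.exp_sum]
  rfl

theorem integrable_apply_gaussianInstance (μ : H.MeanVector) (σ : ℝ≥0) (a : H.JointArm)
    (e : Fin H.numGroups) : Integrable (fun y => y e) (H.gaussianInstance μ σ a) :=
  integrable_comp_eval (μ := fun e => gaussianReal (μ e (H.localPart a e)) (σ ^ 2)) (f := fun x => x)
    ((memLp_id_gaussianReal' 1 ENNReal.one_ne_top).integrable le_rfl)

theorem integral_apply_gaussianInstance (μ : H.MeanVector) (σ : ℝ≥0) (a : H.JointArm)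
    (e : Fin H.numGroups) :
    ∫ y, y e ∂(H.gaussianInstance μ σ a) = μ e (H.localPart a e) := by
  have := integral_comp_eval (μ := fun e => gaussianReal (μ e (H.localPart a e)) (σ ^ 2)) (i := e)
    (f := fun x : ℝ => x) aestronglyMeasurable_id
  exact this.trans integral_id_gaussianReal

theorem integrable_logLikelihood_term (μ : H.MeanVector) (σ : ℝ≥0) (a : H.JointArm)
    (e : Fin H.numGroups) :
    Integrable (fun y : H.Feedback => (μ e (H.localPart a e) * y e -
      μ e (H.localPart a e) ^ 2 / 2) / (σ ^ 2 : ℝ≥0)) (H.gaussianInstance 0 σ a) := by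
  have h : Integrable (fun y : H.Feedback => μ e (H.localPart a e) * y e -
      μ e (H.localPart a e) ^ 2 / 2) (H.gaussianInstance 0 σ a) :=
    ((integrable_apply_gaussianInstance 0 σ a e).const_mul _).sub (integrable_const _)
  exact h.div_const _

theorem integrable_logLikelihood (μ : H.MeanVector) (σ : ℝ≥0) (a : H.JointArm) :
    Integrable (fun y => logLikelihood μ σ (a, y)) (H.gaussianInstance 0 σ a) :=
  integrable_finsetSum _ fun e _ => integrable_logLikelihood_term μ σ a e

theorem integral_logLikelihood (μ : H.MeanVector) (σ : ℝ≥0) (a : H.JointArm) :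
    ∫ y, logLikelihood μ σ (a, y) ∂(H.gaussianInstance 0 σ a) =
      -(∑ e, μ e (H.localPart a e) ^ 2) / (2 * σ ^ 2) := by
  have h := fun e => integrable_apply_gaussianInstance 0 σ a e
  simp only [logLikelihood]
  rw [integral_finsetSum _ fun e _ => integrable_logLikelihood_term μ σ a e]
  rw [neg_div, Finset.sum_div, ← Finset.sum_neg_distrib]
  refine Finset.sum_congr rfl fun e _ => ?_
  rw [integral_div, integral_sub ((h e).const_mul _) (integrable_const _), integral_const_mul,
    integral_apply_gaussianInstance]
  simp
  ring

theorem integrable_arm (π : H.Policy) (ν : Kernel H.JointArm H.Feedback) [IsMarkovKernel ν]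
    (u : H.JointArm → ℝ) (t : ℕ) (s : Fin t) :
    Integrable (fun h => u (h s).1) (H.historyLaw π ν t) :=
  integrable_comp_eval_historyLaw π ν (φ := fun r => u r.1)
    (Measurable.of_discrete.comp measurable_fst) (fun a => integrable_const (u a)) t s

theorem regret_eq (π : H.Policy) (μ : H.MeanVector) (σ : ℝ≥0) (T : ℕ) :
    H.regret π μ σ T = ∫ h, ∑ t : Fin T, (H.optMean μ - H.jointMean μ (h t).1)
      ∂(H.historyLaw π (H.gaussianInstance μ σ) T) := by
  have hφ : Measurable fun r : H.Round => H.optMean μ - ∑ e, r.2 e := by fun_prop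
  have hi : ∀ a, Integrable (fun y : H.Feedback => H.optMean μ - ∑ e, y e)
      (H.gaussianInstance μ σ a) := fun a => (integrable_const _).sub
    (integrable_finsetSum _ fun e _ => integrable_apply_gaussianInstance μ σ a e)
  rw [regret, integral_finsetSum _ fun t _ => integrable_comp_eval_historyLaw π _ hφ hi T t,
    integral_finsetSum _ fun t _ => integrable_arm π _ (fun a => H.optMean μ - H.jointMean μ a) T t]
  refine Finset.sum_congr rfl fun t _ => ?_
  rw [integral_comp_eval_historyLaw π _ hφ hi T t]
  congr 1
  ext h
  rw [integral_sub (integrable_const _)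
    (integrable_finsetSum _ fun e _ => integrable_apply_gaussianInstance μ σ _ e),
    integral_finsetSum _ fun e _ => integrable_apply_gaussianInstance μ σ _ e]
  simp [integral_apply_gaussianInstance, jointMean]

/-- An expectation over histories under means `μ` compared with the one under zero means. -/
theorem integral_historyLaw_gaussianInstance_le (π : H.Policy) (μ : H.MeanVector) {σ : ℝ≥0}
    (hσ : σ ≠ 0) (T : ℕ) {f : H.History T → ℝ} (hf : Measurable f) {B : ℝ} (hf0 : ∀ h, 0 ≤ f h)
    (hfB : ∀ h, f h ≤ B) {l : ℝ} (hl : 0 < l) :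
    ∫ h, f h ∂(H.historyLaw π (H.gaussianInstance μ σ) T) ≤
      ∫ h, f h ∂(H.historyLaw π (H.gaussianInstance 0 σ) T) + B * (2 * l +
        (∫ h, ∑ s, (∑ e, μ e (H.localPart (h s).1 e) ^ 2) / (2 * σ ^ 2)
          ∂(H.historyLaw π (H.gaussianInstance 0 σ) T)) / (2 * l)) := by
  have hΦ := measurable_logLikelihood μ σ
  have hd := historyLaw_eq_withDensity π _ _ hΦ (gaussianInstance_eq_withDensity μ hσ) T
  have hi := integrable_comp_eval_historyLaw π _ hΦ (integrable_logLikelihood μ σ) T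
  have hL : IsProbabilityMeasure ((H.historyLaw π (H.gaussianInstance 0 σ) T).withDensity
      fun h => ENNReal.ofReal (Real.exp (∑ s, logLikelihood μ σ (h s)))) := by
    rw [← hd]; infer_instance
  rw [hd]
  refine (integral_withDensity_exp_le _ (by fun_prop) (integrable_finsetSum _ fun s _ => hi s) hL
    hf hf0 hfB hl).trans_eq ?_
  -- Divergence decomposition: the divergence of the histories is the expected sum of the
  -- divergences of the arms pulled.
  have : -∫ h, ∑ s, logLikelihood μ σ (h s) ∂(H.historyLaw π (H.gaussianInstance 0 σ) T) =
      ∫ h, ∑ s, (∑ e, μ e (H.localPart (h s).1 e) ^ 2) / (2 * σ ^ 2)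
          ∂(H.historyLaw π (H.gaussianInstance 0 σ) T) := by
    rw [integral_finsetSum _ fun s _ => hi s, integral_finsetSum _ fun s _ => integrable_arm π _
      (fun a => (∑ e, μ e (H.localPart a e) ^ 2) / (2 * σ ^ 2)) T s, ← Finset.sum_neg_distrib]
    refine Finset.sum_congr rfl fun s _ => ?_
    rw [integral_comp_eval_historyLaw π _ hΦ (integrable_logLikelihood μ σ) T s, ← integral_neg]
    congr 1
    ext h
    rw [integral_logLikelihood]
    ring
  rw [this]

/-! ### Play counts and instances with one raised local arm. -/

/-- The number of rounds of a history in which the local arm `x` of group `e` was played. -/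
def playCount {t : ℕ} (e : Fin H.numGroups) (x : H.LocalArm e) (h : H.History t) : ℝ :=
  ∑ s, if H.localPart (h s).1 e = x then 1 else 0

theorem playCount_nonneg {t : ℕ} (e : Fin H.numGroups) (x : H.LocalArm e) (h : H.History t) :
    0 ≤ playCount e x h :=
  Finset.sum_nonneg fun s _ => by split_ifs <;> norm_num

theorem playCount_le {t : ℕ} (e : Fin H.numGroups) (x : H.LocalArm e) (h : H.History t) :
    playCount e x h ≤ t := by
  calc playCount e x h ≤ ∑ _s : Fin t, (1 : ℝ) :=
        Finset.sum_le_sum fun s _ => by split_ifs <;> norm_num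
    _ = t := by simp

theorem sum_playCount {t : ℕ} (e : Fin H.numGroups) (h : H.History t) :
    ∑ x : H.LocalArm e, playCount e x h = t := by
  simp only [playCount]
  rw [Finset.sum_comm]
  simp

theorem measurable_playCount {t : ℕ} (e : Fin H.numGroups) (x : H.LocalArm e) :
    Measurable (playCount (H := H) (t := t) e x) :=
  Finset.measurable_sum _ fun s _ =>
    (Measurable.of_discrete (f := fun a => if H.localPart a e = x then (1 : ℝ) else 0)).comp
      (measurable_fst.comp (measurable_pi_apply s))

theorem integrable_playCount (π : H.Policy) (ν : Kernel H.JointArm H.Feedback) [IsMarkovKernel ν]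
    (t : ℕ) (e : Fin H.numGroups) (x : H.LocalArm e) :
    Integrable (playCount e x) (H.historyLaw π ν t) :=
  integrable_finsetSum _ fun s _ =>
    integrable_arm π ν (fun a => if H.localPart a e = x then (1 : ℝ) else 0) t s

/-- Used with `g = id` for joint means and with `g` the square for the divergence. -/
theorem sum_single_localPart (e : Fin H.numGroups) (x : H.LocalArm e) (g : ℝ → ℝ) (hg : g 0 = 0)
    (D : ℝ) (a : H.JointArm) :
    ∑ e', g ((Pi.single e (Pi.single x D) : H.MeanVector) e' (H.localPart a e')) =
      if H.localPart a e = x then g D else 0 := by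
  rw [Finset.sum_eq_single e]
  · rw [Pi.single_eq_same, Pi.single_apply]
    split_ifs <;> simp [hg]
  · intro e' _ he
    rw [Pi.single_eq_of_ne he]
    simp [hg]
  · simp

theorem exists_localPart_eq (hA : ∀ i, 1 ≤ H.numArms i) (e : Fin H.numGroups) (x : H.LocalArm e) :
    ∃ a : H.JointArm, H.localPart a e = x :=
  ⟨fun i => if hi : i ∈ H.group e then x ⟨i, hi⟩ else ⟨0, hA i⟩, by
    funext i
    simp [localPart, i.2]⟩

theorem optMean_single (hA : ∀ i, 1 ≤ H.numArms i) (e : Fin H.numGroups) (x : H.LocalArm e)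
    {D : ℝ} (hD : 0 ≤ D) : H.optMean (Pi.single e (Pi.single x D)) = D := by
  have h := sum_single_localPart e x id rfl D
  simp only [id] at h
  simp only [optMean, jointMean, h]
  obtain ⟨a, ha⟩ := exists_localPart_eq hA e x
  have : Nonempty H.JointArm := ⟨a⟩
  refine le_antisymm (ciSup_le fun a => by split_ifs <;> simp [hD]) ?_
  refine le_ciSup_of_le (Set.finite_range _).bddAbove a ?_
  simp [ha]

theorem regret_single (hA : ∀ i, 1 ≤ H.numArms i) (π : H.Policy) (e : Fin H.numGroups)
    (x : H.LocalArm e) {D : ℝ} (hD : 0 ≤ D) (σ : ℝ≥0) (T : ℕ) :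
    H.regret π (Pi.single e (Pi.single x D)) σ T = D * (T - ∫ h, playCount e x h
      ∂(H.historyLaw π (H.gaussianInstance (Pi.single e (Pi.single x D)) σ) T)) := by
  have h := sum_single_localPart e x id rfl D
  simp only [id] at h
  rw [regret_eq, optMean_single hA e x hD]
  simp only [jointMean, h]
  have : ∀ h : H.History T, ∑ t, (D - if H.localPart (h t).1 e = x then D else 0) =
      D * (T - playCount e x h) := by
    intro h
    rw [Finset.sum_sub_distrib, playCount, mul_sub, Finset.mul_sum]
    simp [mul_comm]
  simp only [this]
  rw [integral_const_mul, integral_sub (integrable_const _) (integrable_playCount π _ T e x)]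
  simp

/-- The change of measure with `f = N_x` and `B = T`. The divergence is itself a multiple of `E_0
N_x`, so the bound is affine in `E_0 N_x` and sums over `x` exactly. -/
theorem integral_playCount_single_le (π : H.Policy) (e : Fin H.numGroups) (x : H.LocalArm e)
    (D : ℝ) {σ : ℝ≥0} (hσ : σ ≠ 0) (T : ℕ) {l : ℝ} (hl : 0 < l) :
    ∫ h, playCount e x h
        ∂(H.historyLaw π (H.gaussianInstance (Pi.single e (Pi.single x D)) σ) T) ≤
      (1 + T * (D ^ 2 / (2 * σ ^ 2)) / (2 * l)) *
        ∫ h, playCount e x h ∂(H.historyLaw π (H.gaussianInstance 0 σ) T) + T * (2 * l) := by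
  refine (integral_historyLaw_gaussianInstance_le π _ hσ T (measurable_playCount e x)
    (playCount_nonneg e x) (playCount_le e x) hl).trans_eq ?_
  have hs := sum_single_localPart e x (fun z => z ^ 2) (by simp) D
  simp only [hs]
  have : ∀ h : H.History T, ∑ s, (if H.localPart (h s).1 e = x then D ^ 2 else 0) / (2 * σ ^ 2 : ℝ)
      = (D ^ 2 / (2 * σ ^ 2)) * playCount e x h := by
    intro h
    rw [playCount, Finset.mul_sum]
    refine Finset.sum_congr rfl fun s _ => ?_
    split_ifs <;> simp
  simp only [this]
  rw [integral_const_mul]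
  ring

theorem sum_integral_playCount (π : H.Policy) (ν : Kernel H.JointArm H.Feedback)
    [IsMarkovKernel ν] (t : ℕ) (e : Fin H.numGroups) :
    ∑ x : H.LocalArm e, ∫ h, playCount e x h ∂(H.historyLaw π ν t) = t := by
  rw [← integral_finsetSum _ fun x _ => integrable_playCount π ν t e x]
  simp [sum_playCount]

/-- For some local arm of a group with at least two local arms, raising its mean by `D` in an
otherwise zero instance makes it be played in at most a constant fraction of the rounds. -/
theorem exists_integral_playCount_single_le (π : H.Policy) (e : Fin H.numGroups)
    (h2 : 2 ≤ Fintype.card (H.LocalArm e)) (D : ℝ) {σ : ℝ≥0} (hσ : σ ≠ 0) (T : ℕ)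
    (hD : D ^ 2 * T ≤ σ ^ 2 / 64 * Fintype.card (H.LocalArm e)) :
    ∃ x : H.LocalArm e, ∫ h, playCount e x h
        ∂(H.historyLaw π (H.gaussianInstance (Pi.single e (Pi.single x D)) σ) T) ≤
      11 / 16 * T := by
  set n : ℝ := (Fintype.card (H.LocalArm e) : ℝ) with hn
  have hn2 : (2 : ℝ) ≤ n := by rw [hn]; exact_mod_cast h2
  have hσ' : (0 : ℝ) < σ := by exact_mod_cast pos_iff_ne_zero.2 hσ
  have : Nonempty (H.LocalArm e) := Fintype.card_pos_iff.1 (by omega)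
  suffices hsum : ∑ x : H.LocalArm e, ∫ h, playCount e x h
        ∂(H.historyLaw π (H.gaussianInstance (Pi.single e (Pi.single x D)) σ) T) ≤
      ∑ _x : H.LocalArm e, 11 / 16 * (T : ℝ) by
    obtain ⟨x, -, hx⟩ := Finset.exists_le_of_sum_le Finset.univ_nonempty hsum
    exact ⟨x, hx⟩
  -- With `l = 1/16` the three terms of the sum are at most `nT/2` (as `n ≥ 2`), `nT/16` and `nT/8`,
  -- in total `11nT/16`.
  refine (Finset.sum_le_sum fun x _ => integral_playCount_single_le π e x D hσ T
    (l := 1 / 16) (by norm_num)).trans ?_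
  rw [Finset.sum_add_distrib, ← Finset.mul_sum, sum_integral_playCount]
  simp only [Finset.sum_const, Finset.card_univ, nsmul_eq_mul, ← hn]
  have hkl : (T : ℝ) * (D ^ 2 / (2 * σ ^ 2)) ≤ n / 128 := by
    have : (T : ℝ) * (D ^ 2 / (2 * σ ^ 2)) = D ^ 2 * T / (2 * σ ^ 2) := by ring
    rw [this, div_le_iff₀ (by positivity)]
    linarith
  have hT : (0 : ℝ) ≤ T := Nat.cast_nonneg T
  generalize (T : ℝ) * (D ^ 2 / (2 * σ ^ 2)) = z at hkl ⊢
  have h1 := mul_le_mul_of_nonneg_right hkl hT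
  have h3 := mul_le_mul_of_nonneg_right hn2 hT
  calc (1 + z / (2 * (1 / 16))) * T + n * (T * (2 * (1 / 16)))
      = T + 8 * (z * T) + n * T / 8 := by ring
    _ ≤ n * (11 / 16 * T) := by linarith

theorem two_le_card_localArm (hA : ∀ i, 1 ≤ H.numArms i) {e : Fin H.numGroups}
    {i : Fin H.numAgents} (hi : i ∈ H.group e) (h2 : 2 ≤ H.numArms i) :
    2 ≤ Fintype.card (H.LocalArm e) := by
  rw [Fintype.card_pi]
  simp only [Fintype.card_fin]
  exact h2.trans (Finset.single_le_prod' (f := fun j : {j // j ∈ H.group e} => H.numArms j.1)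
    (fun j _ => hA j.1) (Finset.mem_univ ⟨i, hi⟩))

end CoordHypergraph

/-! ### Choice of the group and of the gap. -/

theorem theorem2 :
    ∃ c : ℝ, 0 < c ∧
      ∀ H : CoordHypergraph,
        (∀ i, 1 ≤ H.numArms i) →
        (∃ e, ∃ i ∈ H.group e, 2 ≤ H.numArms i) →
        ∀ σ : ℝ≥0, 0 < σ → σ ≤ 1 →
        ∀ T : ℕ, (H.numLocalArms : ℝ) / (H.numGroups : ℝ) ≤ (T : ℝ) →
        ∀ π : H.Policy,
          ∃ μ : H.MeanVector,
            (∀ e x, μ e x ∈ Set.Icc (0 : ℝ) 1) ∧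
            c * σ * Real.sqrt ((H.numLocalArms : ℝ) * (T : ℝ) / (H.numGroups : ℝ))
              ≤ H.regret π μ σ T := by
  -- `5/128 = 1/8 * 5/16`: the factor in the gap `D` times the fraction of rounds that miss `x`.
  refine ⟨5 / 128, by norm_num, fun H hA ⟨e₀, i₀, hi₀, h2⟩ σ hσ hσ1 T hT π => ?_⟩
  obtain ⟨e, -, he⟩ := Finset.exists_max_image Finset.univ
    (fun e => Fintype.card (H.LocalArm e)) ⟨e₀, Finset.mem_univ _⟩
  have hc0 := CoordHypergraph.two_le_card_localArm hA hi₀ h2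
  have hcard : 2 ≤ Fintype.card (H.LocalArm e) := hc0.trans (he e₀ (Finset.mem_univ _))
  have hρ : (0 : ℝ) < H.numGroups := by exact_mod_cast (Nat.zero_le _).trans_lt e₀.2
  have hloc : 0 < H.numLocalArms :=
    (by omega : 0 < Fintype.card (H.LocalArm e₀)).trans_le
      (Finset.single_le_sum (f := fun e => Fintype.card (H.LocalArm e))
        (fun _ _ => Nat.zero_le _) (Finset.mem_univ e₀))
  set K : ℝ := (H.numLocalArms : ℝ) / H.numGroups with hK
  have hKpos : 0 < K := div_pos (by exact_mod_cast hloc) hρ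
  have hTpos : (0 : ℝ) < T := hKpos.trans_le hT
  -- The largest group is at least the average `K`.
  have hKn : K ≤ Fintype.card (H.LocalArm e) := by
    rw [hK, div_le_iff₀ hρ]
    have : H.numLocalArms ≤ H.numGroups * Fintype.card (H.LocalArm e) := by
      simpa [CoordHypergraph.numLocalArms] using Finset.sum_le_card_nsmul Finset.univ
        (fun e => Fintype.card (H.LocalArm e)) _ he
    rw [mul_comm]
    exact_mod_cast this
  set D : ℝ := σ / 8 * Real.sqrt (K / T) with hD
  have hD0 : 0 ≤ D := by positivity
  -- The horizon condition `K ≤ T` and `σ ≤ 1` keep the raised mean in the unit interval.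
  have hD1 : D ≤ 1 := by
    have h1 : Real.sqrt (K / T) ≤ 1 := Real.sqrt_le_one.2 ((div_le_one hTpos).2 hT)
    have h2 : (σ : ℝ) / 8 ≤ 1 := by
      have : (σ : ℝ) ≤ 1 := by exact_mod_cast hσ1
      linarith
    exact mul_le_one₀ h2 (Real.sqrt_nonneg _) h1
  have hDT : D ^ 2 * T = σ ^ 2 / 64 * K := by
    rw [hD, mul_pow, Real.sq_sqrt (by positivity)]
    field_simp
    ring
  obtain ⟨x, hx⟩ := CoordHypergraph.exists_integral_playCount_single_le π e hcard D hσ.ne' T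
    (by rw [hDT]; gcongr)
  refine ⟨Pi.single e (Pi.single x D), fun e' x' => ?_, ?_⟩
  · by_cases he' : e' = e
    · subst he'
      rw [Pi.single_eq_same, Pi.single_apply]
      split_ifs
      exacts [⟨hD0, hD1⟩, ⟨le_rfl, zero_le_one⟩]
    · rw [Pi.single_eq_of_ne he']
      exact ⟨le_rfl, zero_le_one⟩
  · rw [CoordHypergraph.regret_single hA π e x hD0]
    have hsqrt : Real.sqrt (H.numLocalArms * T / H.numGroups) = Real.sqrt (K / T) * T := by
      have : (H.numLocalArms : ℝ) * T / H.numGroups = K / T * T ^ 2 := by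
        rw [hK]
        field_simp
      rw [this, Real.sqrt_mul (by positivity), Real.sqrt_sq hTpos.le]
    rw [hsqrt]
    calc 5 / 128 * σ * (Real.sqrt (K / T) * T) = D * (5 / 16 * T) := by rw [hD]; ring
      _ ≤ _ := mul_le_mul_of_nonneg_left (by linarith) hD0
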